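/- Let $(\Omega,\mathcal F,P)$ be a probability space carrying a two-sided standard Brownian motion $B=(B(s))_{s\in\mathbb R}$: $B(0)=0$ a.s., $B$ has independent increments, $B(t)-B(s)\sim N(0,t-s)$ for $s\le t$, and a.s. continuous paths. For $f\in L^2(\mathbb R)$ let $\int_{\mathbb R}f\,dB$ denote the Wiener integral, i.e. the $L^2(P)$-limit of $\int\varphi_n\,dB=\sum_i c_i\,(B(b_i)-B(a_i))$ along step functions $\varphi_n=\sum_i c_i\mathbf 1_{(a_i,b_i]}$ converging to $f$ in $L^2(\mathbb R)$; and $\int_A f\,dB=\int_{\mathbb R}\mathbf 1_Af\,dB$. Write $x_+^a=x^a$ if $x>0$ and $x_+^a=0$ if $x\le 0$. Let $H\in(0,1)$ and $$C(H)=\left(\int_{-\infty}^0\big[(1-s)^{H-1/2}-(-s)^{H-1/2}\big]^2ds+\frac1{2H}\right)^{1/2}.$$ Then: 1. The Wiener integral of every $f\in L^2(\mathbb R)$ exists and is unique up to null sets. The integral in $C(H)$ converges, $C(H)>0$, and for every $t\ge0$ the integrands in $$Z(t)=\frac1{C(H)}\int_{\mathbb R}\Big((t-s)_+^{H-1/2}-(-s)_+^{H-1/2}\Big)dB(s)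 =\frac1{C(H)}\left(\int_{(-\infty,0)}\big((t-s)^{H-1/2}-(-s)^{H-1/2}\big)dB(s)+\int_{(0,t)}(t-s)^{H-1/2}dB(s)\right)$$ belong to $L^2(\mathbb R)$, and the second equality holds a.s. 2. $(Z(t))_{t\ge0}$ is a fractional Brownian motion with Hurst index $H$: it is a Gaussian process with $E[Z(t)]=0$ and $$E[Z(t)Z(s)]=\tfrac12\big(t^{2H}+s^{2H}-|t-s|^{2H}\big)\qquad(s,t\ge0).$$ 3. If $H\in(1/2,1)$, then for all $t\ge 0$ and all $s\in\mathbb R$ $$(t-s)_+^{H-1/2}-(-s)_+^{H-1/2}=\Gamma(H+\tfrac12)\,\big(I_-^{H-1/2}\mathbf 1_{[0,t]}\big)(s),$$ where $(I_-^{\alpha}f)(s)=\frac1{\Gamma(\alpha)}\int_{\mathbb R}f(u)\,(u-s)_+^{\alpha-1}\,du$ is the Riemann–Liouville fractional integral (the integral here converges absolutely). Consequently $Z(t)=\frac{\Gamma(H+1/2)}{C(H)}\int_{\mathbb R}\big(I_-^{H-1/2}\mathbf 1_{[0,t]}\big)(s)\,dB(s)$ a.s. -/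

import Mathlib

open MeasureTheory ProbabilityTheory Filter Set
open scoped NNReal ENNReal Topology

noncomputable section

namespace MandelbrotVanNess

/-- The truncated power `x₊ᵃ`: it is `xᵃ` for `x > 0` and `0` for `x ≤ 0`, whatever `a` is. -/
def posPow (x a : ℝ) : ℝ := if 0 < x then x ^ a else 0

/-- The kernel `s ↦ (t - s)₊^(H - 1/2) - (-s)₊^(H - 1/2)`. -/
def kernel (H t s : ℝ) : ℝ := posPow (t - s) (H - 1 / 2) - posPow (-s) (H - 1 / 2)

/-- The normalizing constant `C(H)`. -/
def normConst (H : ℝ) : ℝ :=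
  ((∫ s in Iio (0 : ℝ), ((1 - s) ^ (H - 1 / 2) - (-s) ^ (H - 1 / 2)) ^ 2) + 1 / (2 * H))
    ^ (1 / 2 : ℝ)

/-- The Riemann-Liouville fractional integral on the whole line that integrates over `[s, ∞)`:
`(I₋^α f)(s) = Γ(α)⁻¹ ∫ f(u) (u - s)₊^(α - 1) du`. -/
def fracIntMinus (α : ℝ) (f : ℝ → ℝ) (s : ℝ) : ℝ :=
  1 / Real.Gamma α * ∫ u : ℝ, f u * posPow (u - s) (α - 1)

variable {Ω : Type*} [MeasurableSpace Ω]

/-- A standard Brownian motion indexed by the whole real line. -/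
structure IsTwoSidedBrownianMotion (B : ℝ → Ω → ℝ) (P : Measure Ω) : Prop where
  zero : ∀ᵐ ω ∂P, B 0 ω = 0
  indep_increments : HasIndepIncrements B P
  law_increment : ∀ s t : ℝ, s ≤ t →
    HasLaw (fun ω ↦ B t ω - B s ω) (gaussianReal 0 (t - s).toNNReal) P
  continuous_paths : ∀ᵐ ω ∂P, Continuous fun t ↦ B t ω

/-- A deterministic step function, presented as a finite linear combination
`∑ i, coeff i • 1_(left i, right i]` of indicators of bounded intervals. -/
structure StepFunction where
  card : ℕ
  coeff : Fin card → ℝ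
  left : Fin card → ℝ
  right : Fin card → ℝ
  left_le_right : ∀ i, left i ≤ right i

/-- The function on the line that a step function denotes. -/
def StepFunction.toFun (φ : StepFunction) (s : ℝ) : ℝ :=
  ∑ i, φ.coeff i * (Ioc (φ.left i) (φ.right i)).indicator (fun _ ↦ (1 : ℝ)) s

/-- The elementary integral `∫ φ dB = ∑ i, coeff i * (B (right i) - B (left i))`. -/
def StepFunction.integral (φ : StepFunction) (B : ℝ → Ω → ℝ) (ω : Ω) : ℝ :=
  ∑ i, φ.coeff i * (B (φ.right i) ω - B (φ.left i) ω)

/-- `Y` is (a version of) the Wiener integral `∫ f dB` of `f ∈ L²(ℝ)`: it is the limit in `L²(P)`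
of the elementary integrals of step functions that converge to `f` in `L²(ℝ)`. -/
def IsWienerIntegral (B : ℝ → Ω → ℝ) (P : Measure Ω) (f : ℝ → ℝ) (Y : Ω → ℝ) : Prop :=
  MemLp f 2 volume ∧ MemLp Y 2 P ∧
    ∃ φ : ℕ → StepFunction,
      Tendsto (fun n ↦ eLpNorm (fun s ↦ (φ n).toFun s - f s) 2 volume) atTop (𝓝 0) ∧
      Tendsto (fun n ↦ eLpNorm (fun ω ↦ (φ n).integral B ω - Y ω) 2 P) atTop (𝓝 0)

open Classical in
/-- The Wiener integral `∫ f dB` (a version of it; `0` if there is none). -/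
def wienerIntegral (B : ℝ → Ω → ℝ) (P : Measure Ω) (f : ℝ → ℝ) : Ω → ℝ :=
  if h : ∃ Y, IsWienerIntegral B P f Y then h.choose else 0

/-- The Wiener integral `∫_A f dB` over a subset `A` of the line. -/
def wienerIntegralOn (B : ℝ → Ω → ℝ) (P : Measure Ω) (A : Set ℝ) (f : ℝ → ℝ) : Ω → ℝ :=
  wienerIntegral B P (A.indicator f)

/-- A fractional Brownian motion of Hurst index `H ∈ (0, 1)`: a centred Gaussian process
`(X t)`, `t ≥ 0`, with covariance `(t^(2H) + s^(2H) - |t - s|^(2H)) / 2`. -/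
structure IsFractionalBrownianMotion (H : ℝ) (X : ℝ≥0 → Ω → ℝ) (P : Measure Ω) : Prop where
  hurst_mem : H ∈ Ioo (0 : ℝ) 1
  gaussian : IsGaussianProcess X P
  mean_zero : ∀ t, ∫ ω, X t ω ∂P = 0
  covariance : ∀ t s : ℝ≥0, ∫ ω, X t ω * X s ω ∂P =
    1 / 2 * ((t : ℝ) ^ (2 * H) + (s : ℝ) ^ (2 * H) - |(t : ℝ) - (s : ℝ)| ^ (2 * H))

end MandelbrotVanNess

end

open MandelbrotVanNess

open MandelbrotVanNess

/-! The elementary integral is an isometry from step functions in `L²(ℝ)` to `L²(P)`: the mixed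
second moment of two Brownian increments is the length of the overlap of their intervals. Step
functions are dense, so completeness of `L²(P)` gives existence of the Wiener integral, and the
isometry in the limit gives uniqueness. Gaussianity survives because `L²` limits of Gaussian
variables are Gaussian. For `Z` everything then reduces to the norms of the kernels. Homogeneity
(`kernel_eq_rescale`) gives `‖kernel H t‖² = t^(2H) C(H)²`, and translation (`kernel_sub_kernel`)
gives `‖kernel H t - kernel H s‖² = |t - s|^(2H) C(H)²`; polarization turns these into the
covariance. The analytic input is that the kernel at time 1 is square integrable with norm `C(H)`.
For `H > 1/2` the kernel is obtained by integrating `x₊^(H - 3/2)` over `[-s, t - s]`, which is the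
fractional integral up to a Gamma factor. -/

namespace MandelbrotVanNess

/-! ### Gaussian laws under `L²` limits. -/

section GaussianLimits

variable {Ω : Type*} [MeasurableSpace Ω] {P : Measure Ω}

/-- Convergence in `L²` implies convergence of the second moments. -/
theorem tendsto_integral_sq_of_tendsto_eLpNorm {U : ℕ → Ω → ℝ} {V : Ω → ℝ}
    (hU : ∀ n, MemLp (U n) 2 P) (hV : MemLp V 2 P)
    (h : Tendsto (fun n ↦ eLpNorm (U n - V) 2 P) atTop (𝓝 0)) :
    Tendsto (fun n ↦ ∫ ω, U n ω ^ 2 ∂P) atTop (𝓝 (∫ ω, V ω ^ 2 ∂P)) := by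
  have key : ∀ {W : Ω → ℝ} (hW : MemLp W 2 P), ∫ ω, W ω ^ 2 ∂P = ‖hW.toLp W‖ ^ 2 := by
    intro W hW
    rw [← real_inner_self_eq_norm_sq, L2.inner_def]
    refine integral_congr_ae ?_
    filter_upwards [hW.coeFn_toLp] with ω hω
    simp [hω, sq]
  have hlim := (Lp.tendsto_Lp_iff_tendsto_eLpNorm'' U hU V hV).2 h
  simp_rw [fun n ↦ key (hU n), key hV]
  exact hlim.norm.pow 2

/-- A limit in `L²` of Gaussian random variables is Gaussian. -/
theorem hasGaussianLaw_of_tendsto_eLpNorm [IsProbabilityMeasure P] {U : ℕ → Ω → ℝ} {V : Ω → ℝ}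
    (hU : ∀ n, HasGaussianLaw (U n) P) (hV : MemLp V 2 P)
    (h : Tendsto (fun n ↦ eLpNorm (U n - V) 2 P) atTop (𝓝 0)) :
    HasGaussianLaw V P := by
  have hU2 : ∀ n, MemLp (U n) 2 P := fun n ↦ (hU n).memLp_two
  have hmean : Tendsto (fun n ↦ ∫ ω, U n ω ∂P) atTop (𝓝 (∫ ω, V ω ∂P)) := by
    refine tendsto_integral_of_L1' V hV.aestronglyMeasurable
      (Eventually.of_forall fun n ↦ (hU2 n).integrable one_le_two) ?_
    refine tendsto_of_tendsto_of_tendsto_of_le_of_le tendsto_const_nhds h (fun _ ↦ zero_le) ?_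
    exact fun n ↦ eLpNorm_le_eLpNorm_of_exponent_le one_le_two
      ((hU2 n).aestronglyMeasurable.sub hV.aestronglyMeasurable)
  have hsq := tendsto_integral_sq_of_tendsto_eLpNorm hU2 hV h
  have hvar : Tendsto (fun n ↦ Var[U n; P]) atTop (𝓝 Var[V; P]) := by
    simp_rw [fun n ↦ variance_eq_sub (hU2 n), variance_eq_sub hV]
    exact hsq.sub (hmean.pow 2)
  have hdist : TendstoInDistribution U atTop V (fun _ ↦ P) P :=
    TendstoInMeasure.tendstoInDistribution
      (tendstoInMeasure_of_tendsto_eLpNorm two_ne_zero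
        (fun n ↦ (hU2 n).aestronglyMeasurable) hV.aestronglyMeasurable h)
      (fun n ↦ (hU2 n).aemeasurable)
  -- A Gaussian characteristic function depends continuously on mean and variance, and both
  -- converge; convergence in distribution identifies the limit.
  rw [hasGaussianLaw_iff_charFun_map_eq hV.aemeasurable]
  intro t
  have hchar := ProbabilityMeasure.tendsto_iff_tendsto_charFun.1 hdist.tendsto t
  refine tendsto_nhds_unique hchar ?_
  have hform : ∀ {W : Ω → ℝ}, (∫ ω, inner ℝ t (W ω) ∂P) = t * ∫ ω, W ω ∂P ∧
      Var[fun ω ↦ inner ℝ t (W ω); P] = t ^ 2 * Var[W; P] := by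
    intro W
    constructor
    · simp [integral_const_mul, mul_comm]
    · rw [← variance_const_mul]
      simp [mul_comm]
  simp only [ProbabilityMeasure.coe_mk]
  simp_rw [fun n ↦ (hU n).charFun_map_eq t, hform]
  refine (Complex.continuous_exp.tendsto _).comp ?_
  refine Tendsto.sub (Tendsto.mul_const _ ?_) (Tendsto.div_const ?_ _)
  · exact (Complex.continuous_ofReal.tendsto _).comp (hmean.const_mul t)
  · exact (Complex.continuous_ofReal.tendsto _).comp (hvar.const_mul (t ^ 2))

/-- A pointwise limit in `L²` of Gaussian processes is a Gaussian process. -/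
theorem isGaussianProcess_of_tendsto_eLpNorm [IsProbabilityMeasure P] {T : Type*}
    {X : ℕ → T → Ω → ℝ} {Y : T → Ω → ℝ} (hX : ∀ n, IsGaussianProcess (X n) P)
    (hY : ∀ t, MemLp (Y t) 2 P)
    (h : ∀ t, Tendsto (fun n ↦ eLpNorm (X n t - Y t) 2 P) atTop (𝓝 0)) :
    IsGaussianProcess Y P where
  hasGaussianLaw I := by
    classical
    have hmeas : AEMeasurable (fun ω ↦ I.restrict (Y · ω)) P :=
      aemeasurable_pi_lambda _ fun i ↦ (hY i).aemeasurable
    refine ⟨isGaussian_of_isGaussian_map fun L ↦ ?_⟩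
    rw [AEMeasurable.map_map_of_aemeasurable (by fun_prop) hmeas]
    -- Joint Gaussianity is tested on linear functionals; in coordinates these are finite sums, so
    -- their `L²` convergence follows from that of each coordinate.
    have hL : ∀ x : I → ℝ, L x = ∑ i, x i * L (Pi.single i 1) := fun x ↦ by
      refine (LinearMap.pi_apply_eq_sum_univ L.toLinearMap x).trans ?_
      refine Finset.sum_congr rfl fun i _ ↦ ?_
      simp only [smul_eq_mul, ContinuousLinearMap.coe_coe]
      congr 2
      ext j
      simp [Pi.single_apply, eq_comm]
    refine (hasGaussianLaw_of_tendsto_eLpNorm (P := P)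
      (U := fun n ω ↦ L (I.restrict (X n · ω))) (fun n ↦ ((hX n).hasGaussianLaw I).map_fun L)
      ?_ ?_).isGaussian_map
    · have : (L ∘ fun ω ↦ I.restrict (Y · ω)) = fun ω ↦ ∑ i : I, Y i ω * L (Pi.single i 1) := by
        ext ω
        exact hL _
      rw [this]
      exact memLp_finsetSum _ fun i _ ↦ (hY i).mul_const _
    · have heq : ∀ n, ((fun ω ↦ L (I.restrict (X n · ω))) - (L ∘ fun ω ↦ I.restrict (Y · ω))) =
          ∑ i : I, L (Pi.single i 1) • (X n i - Y i) := by
        intro n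
        ext ω
        simp only [Pi.sub_apply, Function.comp_apply]
        rw [hL, hL, ← Finset.sum_sub_distrib]
        simp only [Finset.sum_apply, Pi.smul_apply, Pi.sub_apply, smul_eq_mul, Finset.restrict_def]
        exact Finset.sum_congr rfl fun i _ ↦ by ring
      have hlim : Tendsto (fun n ↦ ∑ i : I, ‖L (Pi.single i 1)‖ₑ * eLpNorm (X n i - Y i) 2 P)
          atTop (𝓝 0) := by
        have := tendsto_finsetSum (Finset.univ : Finset I) fun i _ ↦
          ENNReal.Tendsto.const_mul (a := ‖L (Pi.single i 1)‖ₑ) (h i) (Or.inr (by simp))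
        simpa using this
      refine tendsto_of_tendsto_of_tendsto_of_le_of_le tendsto_const_nhds hlim
        (fun _ ↦ zero_le) fun n ↦ ?_
      simp only [heq]
      refine (eLpNorm_sum_le (fun i _ ↦ ?_) one_le_two).trans
        (Finset.sum_le_sum fun i _ ↦ (eLpNorm_const_smul _ _ _ _).le)
      exact (((hX n).hasGaussianLaw_eval i).memLp_two.aestronglyMeasurable.sub
        (hY i).aestronglyMeasurable).const_smul _

end GaussianLimits

/-! ### Gaussianity and second moments of two-sided Brownian motion. -/

section Brownian

variable {Ω : Type*} [MeasurableSpace Ω] {P : Measure Ω} {B : ℝ → Ω → ℝ}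

/-- Restarting at `a` gives a process on `ℝ≥0` that vanishes at time 0, so independent Gaussian
increments determine its joint laws. -/
theorem IsTwoSidedBrownianMotion.isGaussianProcess_shift (hB : IsTwoSidedBrownianMotion B P)
    (a : ℝ) : IsGaussianProcess (fun (t : ℝ≥0) ω ↦ B (a + t) ω - B a ω) P := by
  refine HasIndepIncrements.isGaussianProcess (fun t ↦ ?_) ?_ ?_
  · exact (hB.law_increment a (a + t) (by simp)).hasGaussianLaw
  · simp
  · intro n t ht
    have := hB.indep_increments n (fun i ↦ a + (t i : ℝ))
      (fun i j hij ↦ by simpa using ht hij)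
    simpa using this

theorem IsTwoSidedBrownianMotion.isGaussianProcess (hB : IsTwoSidedBrownianMotion B P) :
    IsGaussianProcess B P where
  hasGaussianLaw I := by
    classical
    -- With `a` below `I` and below 0, `B t - B 0` is a difference of two values of the process
    -- restarted at `a`.
    obtain ⟨a, ha⟩ := (insert 0 I).bddBelow
    have ha0 : a ≤ 0 := ha (by simp)
    have haI : ∀ t ∈ I, a ≤ t := fun t ht ↦ ha (by simp [ht])
    have hshift := hB.isGaussianProcess_shift a
    have hG := hshift.of_isGaussianProcess
      (Y := fun (t : I) ω ↦ B t ω - B 0 ω) fun t ↦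
        ⟨{(t - a : ℝ).toNNReal, (-a).toNNReal},
          ContinuousLinearMap.proj ⟨(t - a : ℝ).toNNReal, by simp⟩ -
            ContinuousLinearMap.proj ⟨(-a).toNNReal, by simp⟩, fun ω ↦ by
          have h1 : a ≤ t := haI t t.2
          simp [h1, ha0]⟩
    have hG' : IsGaussianProcess (fun (t : I) ω ↦ B t ω) P := hG.congr fun t ↦ by
      filter_upwards [hB.zero] with ω hω
      simp [hω]
    have := (hG'.hasGaussianLaw Finset.univ).map
      (ContinuousLinearMap.pi fun t : I ↦
        ContinuousLinearMap.proj (R := ℝ) (φ := fun _ : (Finset.univ : Finset I) ↦ ℝ)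
          ⟨t, Finset.mem_univ t⟩)
    exact this

theorem IsTwoSidedBrownianMotion.memLp_increment (hB : IsTwoSidedBrownianMotion B P) (s t : ℝ) :
    MemLp (fun ω ↦ B t ω - B s ω) 2 P :=
  hB.isGaussianProcess.hasGaussianLaw_fun_sub.memLp_two

theorem IsTwoSidedBrownianMotion.integral_increment (hB : IsTwoSidedBrownianMotion B P)
    {s t : ℝ} (hst : s ≤ t) : ∫ ω, (B t ω - B s ω) ∂P = 0 := by
  have := (hB.law_increment s t hst).integral_eq
  simpa using this

theorem IsTwoSidedBrownianMotion.integral_increment_sq (hB : IsTwoSidedBrownianMotion B P)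
    (s t : ℝ) : ∫ ω, (B t ω - B s ω) ^ 2 ∂P = |t - s| := by
  have := hB.isGaussianProcess.isProbabilityMeasure
  have key : ∀ {s t : ℝ}, s ≤ t → ∫ ω, (B t ω - B s ω) ^ 2 ∂P = |t - s| := by
    intro s t hst
    have h1 := (hB.law_increment s t hst).variance_eq
    rw [variance_id_gaussianReal, variance_eq_sub (hB.memLp_increment s t),
      hB.integral_increment hst] at h1
    rw [abs_of_nonneg (sub_nonneg.2 hst)]
    simpa [hst] using h1
  rcases le_total s t with h | h
  · exact key h
  · rw [abs_sub_comm, ← key h]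
    exact integral_congr_ae (Eventually.of_forall fun ω ↦ by ring)

/-- Polarization into four squared increments avoids distinguishing how the intervals overlap. The
right-hand side is the one in `integral_indicator_Ioc_mul`, so the isometry can be checked term by
term. -/
theorem IsTwoSidedBrownianMotion.integral_increment_mul (hB : IsTwoSidedBrownianMotion B P)
    (a b c d : ℝ) : ∫ ω, (B b ω - B a ω) * (B d ω - B c ω) ∂P =
      (|b - c| + |d - a| - |b - d| - |c - a|) / 2 := by
  have h : ∀ ω, (B b ω - B a ω) * (B d ω - B c ω) = ((B b ω - B c ω) ^ 2 + (B d ω - B a ω) ^ 2 -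
      (B b ω - B d ω) ^ 2 - (B c ω - B a ω) ^ 2) / 2 := fun ω ↦ by ring
  have hi : ∀ s t, Integrable (fun ω ↦ (B t ω - B s ω) ^ 2) P :=
    fun s t ↦ (hB.memLp_increment s t).integrable_sq
  simp_rw [h]
  have hadd : Integrable (fun ω ↦ (B b ω - B c ω) ^ 2 + (B d ω - B a ω) ^ 2) P :=
    (hi c b).add (hi a d)
  have hsub : Integrable (fun ω ↦ (B b ω - B c ω) ^ 2 + (B d ω - B a ω) ^ 2 -
      (B b ω - B d ω) ^ 2) P := hadd.sub (hi d b)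
  rw [integral_div, integral_sub hsub (hi a c), integral_sub hadd (hi d b),
    integral_add (hi c b) (hi a d)]
  simp_rw [hB.integral_increment_sq]

theorem integral_indicator_Ioc_mul {a b c d : ℝ} (hab : a ≤ b) (hcd : c ≤ d) :
    ∫ s, (Ioc a b).indicator (fun _ ↦ (1 : ℝ)) s * (Ioc c d).indicator (fun _ ↦ (1 : ℝ)) s =
      (|b - c| + |d - a| - |b - d| - |c - a|) / 2 := by
  have h : ∀ s, (Ioc a b).indicator (fun _ ↦ (1 : ℝ)) s * (Ioc c d).indicator (fun _ ↦ (1 : ℝ)) s =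
      (Ioc (max a c) (min b d)).indicator (fun _ ↦ (1 : ℝ)) s := fun s ↦ by
    rw [← Ioc_inter_Ioc, ← inter_indicator_mul]
    simp only [mul_one]
  simp_rw [h]
  rw [integral_indicator measurableSet_Ioc]
  simp only [integral_const, MeasurableSet.univ, measureReal_restrict_apply, univ_inter,
    Real.volume_real_Ioc, smul_eq_mul, mul_one]
  grind

end Brownian

theorem integral_sum_smul_sq {α ι : Type*} [Fintype ι] [MeasurableSpace α] (μ : Measure α)
    (c : ι → ℝ) (f : ι → α → ℝ) (hf : ∀ i, MemLp (f i) 2 μ) :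
    ∫ x, (∑ i, c i * f i x) ^ 2 ∂μ = ∑ i, ∑ j, c i * c j * ∫ x, f i x * f j x ∂μ := by
  have h : ∀ x, (∑ i, c i * f i x) ^ 2 = ∑ i, ∑ j, c i * c j * (f i x * f j x) := fun x ↦ by
    rw [sq, Finset.sum_mul_sum]
    exact Finset.sum_congr rfl fun i _ ↦ Finset.sum_congr rfl fun j _ ↦ by ring
  have hi : ∀ i j, Integrable (fun x ↦ c i * c j * (f i x * f j x)) μ :=
    fun i j ↦ ((hf i).integrable_mul (hf j)).const_mul _
  simp_rw [h]
  rw [integral_finsetSum _ fun i _ ↦ integrable_finsetSum _ fun j _ ↦ hi i j]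
  refine Finset.sum_congr rfl fun i _ ↦ ?_
  rw [integral_finsetSum _ fun j _ ↦ hi i j]
  exact Finset.sum_congr rfl fun j _ ↦ integral_const_mul _ _

/-! ### Linear structure and isometry of the elementary integral. -/

namespace StepFunction

/-- The sum of two step functions. -/
def add (φ ψ : StepFunction) : StepFunction where
  card := φ.card + ψ.card
  coeff := Fin.append φ.coeff ψ.coeff
  left := Fin.append φ.left ψ.left
  right := Fin.append φ.right ψ.right
  left_le_right i := by
    refine Fin.addCases (fun i ↦ ?_) (fun i ↦ ?_) i
    · simpa using φ.left_le_right i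
    · simpa using ψ.left_le_right i

/-- A scalar multiple of a step function. -/
def smul (c : ℝ) (φ : StepFunction) : StepFunction :=
  { φ with coeff := fun i ↦ c * φ.coeff i }

/-- The indicator of `(a, b]`. -/
def ofIoc {a b : ℝ} (h : a ≤ b) : StepFunction where
  card := 1
  coeff _ := 1
  left _ := a
  right _ := b
  left_le_right _ := h

theorem toFun_add (φ ψ : StepFunction) : (φ.add ψ).toFun = φ.toFun + ψ.toFun := by
  ext s
  simp only [toFun, add, Pi.add_apply]
  refine (Fin.sum_univ_add _).trans ?_
  simp only [Fin.append_left, Fin.append_right]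

theorem toFun_smul (c : ℝ) (φ : StepFunction) : (φ.smul c).toFun = c • φ.toFun := by
  ext s
  simp only [toFun, smul, Pi.smul_apply, smul_eq_mul, Finset.mul_sum, mul_assoc]
  rfl

theorem toFun_ofIoc {a b : ℝ} (h : a ≤ b) :
    (ofIoc h).toFun = (Ioc a b).indicator fun _ ↦ (1 : ℝ) := by
  ext s
  simp only [toFun]
  exact (Fin.sum_univ_one _).trans (one_mul _)

variable {Ω : Type*} (B : ℝ → Ω → ℝ)

theorem integral_add (φ ψ : StepFunction) :
    (φ.add ψ).integral B = φ.integral B + ψ.integral B := by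
  ext ω
  simp only [integral, add, Pi.add_apply]
  refine (Fin.sum_univ_add _).trans ?_
  simp only [Fin.append_left, Fin.append_right]

theorem integral_smul (c : ℝ) (φ : StepFunction) :
    (φ.smul c).integral B = c • φ.integral B := by
  ext ω
  simp only [integral, smul, Pi.smul_apply, smul_eq_mul, Finset.mul_sum, mul_assoc]
  rfl

theorem memLp_indicator_Ioc (a b : ℝ) :
    MemLp ((Ioc a b).indicator fun _ ↦ (1 : ℝ)) 2 volume :=
  memLp_indicator_const 2 measurableSet_Ioc 1 (Or.inr (by simp))

theorem memLp_toFun (φ : StepFunction) : MemLp φ.toFun 2 volume :=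
  memLp_finsetSum _ fun _ _ ↦ (memLp_indicator_Ioc _ _).const_mul _

variable {B} [MeasurableSpace Ω] {P : Measure Ω}

theorem memLp_integral (hB : IsTwoSidedBrownianMotion B P) (φ : StepFunction) :
    MemLp (φ.integral B) 2 P :=
  memLp_finsetSum _ fun _ _ ↦ (hB.memLp_increment _ _).const_mul _

theorem integral_integral (hB : IsTwoSidedBrownianMotion B P) (φ : StepFunction) :
    ∫ ω, φ.integral B ω ∂P = 0 := by
  have := hB.isGaussianProcess.isProbabilityMeasure
  simp only [integral]
  rw [integral_finsetSum _ fun i _ ↦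
    ((hB.memLp_increment _ _).const_mul _).integrable one_le_two]
  refine Finset.sum_eq_zero fun i _ ↦ ?_
  rw [integral_const_mul, hB.integral_increment (φ.left_le_right i), mul_zero]

/-- The isometry property of the elementary integral. -/
theorem integral_integral_sq (hB : IsTwoSidedBrownianMotion B P) (φ : StepFunction) :
    ∫ ω, φ.integral B ω ^ 2 ∂P = ∫ s, φ.toFun s ^ 2 := by
  simp only [integral, toFun]
  rw [integral_sum_smul_sq P φ.coeff (fun i ω ↦ B (φ.right i) ω - B (φ.left i) ω)
      (fun i ↦ hB.memLp_increment _ _),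
    integral_sum_smul_sq volume φ.coeff
      (fun i ↦ (Ioc (φ.left i) (φ.right i)).indicator fun _ ↦ (1 : ℝ))
      (fun i ↦ memLp_indicator_Ioc _ _)]
  refine Finset.sum_congr rfl fun i _ ↦ Finset.sum_congr rfl fun j _ ↦ ?_
  rw [hB.integral_increment_mul,
    integral_indicator_Ioc_mul (φ.left_le_right i) (φ.left_le_right j)]

/-- Indexing by all step functions at once makes any choice of approximants jointly Gaussian by mere
reindexing. -/
theorem isGaussianProcess_integral (hB : IsTwoSidedBrownianMotion B P) :
    IsGaussianProcess (fun φ : StepFunction ↦ φ.integral B) P := by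
  classical
  refine hB.isGaussianProcess.of_isGaussianProcess fun φ ↦
    ⟨Finset.univ.image φ.left ∪ Finset.univ.image φ.right,
      ∑ i, φ.coeff i • (ContinuousLinearMap.proj ⟨φ.right i, by simp⟩ -
        ContinuousLinearMap.proj ⟨φ.left i, by simp⟩), fun ω ↦ ?_⟩
  simp [integral]

end StepFunction

/-! ### `L²` norms and density of step functions. -/

section L2

variable {α : Type*} [MeasurableSpace α] {μ : Measure α}

theorem eLpNorm_two_eq_ofReal_sqrt {f : α → ℝ} (hf : MemLp f 2 μ) :
    eLpNorm f 2 μ = ENNReal.ofReal (√(∫ x, f x ^ 2 ∂μ)) := by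
  rw [hf.eLpNorm_eq_integral_rpow_norm two_ne_zero ENNReal.ofNat_ne_top, Real.sqrt_eq_rpow]
  simp

theorem integral_sq_eq_of_eLpNorm_eq {β : Type*} [MeasurableSpace β] {ν : Measure β}
    {f : α → ℝ} {g : β → ℝ} (hf : MemLp f 2 μ) (hg : MemLp g 2 ν)
    (h : eLpNorm f 2 μ = eLpNorm g 2 ν) : ∫ x, f x ^ 2 ∂μ = ∫ x, g x ^ 2 ∂ν := by
  rw [eLpNorm_two_eq_ofReal_sqrt hf, eLpNorm_two_eq_ofReal_sqrt hg,
    ENNReal.ofReal_eq_ofReal_iff (Real.sqrt_nonneg _) (Real.sqrt_nonneg _),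
    Real.sqrt_inj (integral_nonneg fun _ ↦ sq_nonneg _) (integral_nonneg fun _ ↦ sq_nonneg _)] at h
  exact h

end L2

theorem StepFunction.eLpNorm_integral_sub {Ω : Type*} [MeasurableSpace Ω] {P : Measure Ω}
    {B : ℝ → Ω → ℝ} (hB : IsTwoSidedBrownianMotion B P)
    (φ ψ : StepFunction) : eLpNorm (φ.integral B - ψ.integral B) 2 P =
      eLpNorm (φ.toFun - ψ.toFun) 2 volume := by
  have h1 : φ.integral B - ψ.integral B = (φ.add (ψ.smul (-1))).integral B := by
    rw [integral_add, integral_smul, neg_one_smul, sub_eq_add_neg]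
  have h2 : φ.toFun - ψ.toFun = (φ.add (ψ.smul (-1))).toFun := by
    rw [toFun_add, toFun_smul, neg_one_smul, sub_eq_add_neg]
  rw [h1, h2, eLpNorm_two_eq_ofReal_sqrt (memLp_integral hB _),
    eLpNorm_two_eq_ofReal_sqrt (memLp_toFun _), integral_integral_sq hB]

/-- Step functions are dense in `L²(ℝ)`. -/
theorem exists_stepFunction_tendsto {f : ℝ → ℝ} (hf : MemLp f 2 volume) :
    ∃ φ : ℕ → StepFunction,
      Tendsto (fun n ↦ eLpNorm ((φ n).toFun - f) 2 volume) atTop (𝓝 0) := by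
  let S : Submodule ℝ (Lp ℝ 2 (volume : Measure ℝ)) :=
    { carrier := {g | ∃ φ : StepFunction, φ.memLp_toFun.toLp φ.toFun = g}
      zero_mem' := ⟨⟨0, 0, 0, 0, fun _ ↦ le_rfl⟩, by
        rw [← MemLp.toLp_zero (MemLp.zero' (p := 2) (μ := (volume : Measure ℝ)) (ε := ℝ))]
        rfl⟩
      add_mem' := by
        rintro _ _ ⟨φ, rfl⟩ ⟨ψ, rfl⟩
        refine ⟨φ.add ψ, ?_⟩
        rw [← MemLp.toLp_add]
        simp only [StepFunction.toFun_add]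
      smul_mem' := by
        rintro c _ ⟨φ, rfl⟩
        refine ⟨φ.smul c, ?_⟩
        rw [← MemLp.toLp_const_smul]
        simp only [StepFunction.toFun_smul] }
  have hS : S.topologicalClosure = ⊤ := by
    -- Density is shown through the orthogonal complement: a `g` orthogonal to step functions
    -- integrates to 0 over every interval, hence vanishes a.e. by Lebesgue differentiation.
    rw [Submodule.topologicalClosure_eq_top_iff, Submodule.eq_bot_iff]
    intro g hg
    have hloc : LocallyIntegrable g volume := (Lp.memLp g).locallyIntegrable one_le_two
    have hzero : ∀ a b : ℝ, ∫ x in a..b, g x = 0 := by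
      have hIoc : ∀ {a b : ℝ}, a ≤ b → ∫ x in a..b, g x = 0 := by
        intro a b hab
        have h1 := (Submodule.mem_orthogonal _ _).1 hg _ ⟨StepFunction.ofIoc hab, rfl⟩
        rw [L2.inner_def] at h1
        rw [intervalIntegral.integral_of_le hab, ← h1, ← integral_indicator measurableSet_Ioc]
        refine integral_congr_ae ?_
        filter_upwards [(StepFunction.ofIoc hab).memLp_toFun.coeFn_toLp] with x hx
        rw [hx, StepFunction.toFun_ofIoc]
        by_cases hxm : x ∈ Ioc a b <;> simp [hxm]
      intro a b
      rcases le_total a b with h | h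
      · exact hIoc h
      · rw [intervalIntegral.integral_symm, hIoc h, neg_zero]
    rw [Lp.eq_zero_iff_ae_eq_zero]
    filter_upwards [LocallyIntegrable.ae_hasDerivAt_integral hloc] with x hx
    have h1 := hx 0
    simp_rw [hzero] at h1
    exact h1.unique (hasDerivAt_const x 0)
  have hmem : hf.toLp f ∈ closure (S : Set (Lp ℝ 2 (volume : Measure ℝ))) := by
    rw [← Submodule.topologicalClosure_coe, hS]
    exact Submodule.mem_top
  obtain ⟨g, hgS, hg⟩ := mem_closure_iff_seq_limit.1 hmem
  choose φ hφ using hgS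
  refine ⟨φ, (Lp.tendsto_Lp_iff_tendsto_eLpNorm'' _ (fun n ↦ (φ n).memLp_toFun) f hf).1 ?_⟩
  simpa only [hφ] using hg

/-! ### Existence, uniqueness and Gaussianity of the Wiener integral. -/

section WienerIntegral

variable {Ω : Type*} [MeasurableSpace Ω] {P : Measure Ω} {B : ℝ → Ω → ℝ}

theorem tendsto_eLpNorm_add_of_tendsto {α : Type*} [MeasurableSpace α] {μ : Measure α}
    {u v : ℕ → α → ℝ} (hu : ∀ n, AEStronglyMeasurable (u n) μ)
    (hv : ∀ n, AEStronglyMeasurable (v n) μ)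
    (hu0 : Tendsto (fun n ↦ eLpNorm (u n) 2 μ) atTop (𝓝 0))
    (hv0 : Tendsto (fun n ↦ eLpNorm (v n) 2 μ) atTop (𝓝 0)) :
    Tendsto (fun n ↦ eLpNorm (u n + v n) 2 μ) atTop (𝓝 0) := by
  refine tendsto_of_tendsto_of_tendsto_of_le_of_le tendsto_const_nhds
    (by simpa using hu0.add hv0) (fun _ ↦ zero_le) fun n ↦ ?_
  exact eLpNorm_add_le (hu n) (hv n) one_le_two

theorem exists_isWienerIntegral (hB : IsTwoSidedBrownianMotion B P) {f : ℝ → ℝ}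
    (hf : MemLp f 2 volume) : ∃ Y, IsWienerIntegral B P f Y := by
  obtain ⟨φ, hφ⟩ := exists_stepFunction_tendsto hf
  have hc : CauchySeq fun n ↦ (φ n).memLp_toFun.toLp (φ n).toFun :=
    ((Lp.tendsto_Lp_iff_tendsto_eLpNorm'' _ (fun n ↦ (φ n).memLp_toFun) f hf).2 hφ).cauchySeq
  have hc' : CauchySeq fun n ↦ ((φ n).memLp_integral hB).toLp ((φ n).integral B) := by
    rw [Metric.cauchySeq_iff] at hc ⊢
    have : ∀ m n, dist (((φ m).memLp_integral hB).toLp ((φ m).integral B))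
        (((φ n).memLp_integral hB).toLp ((φ n).integral B)) =
        dist ((φ m).memLp_toFun.toLp (φ m).toFun) ((φ n).memLp_toFun.toLp (φ n).toFun) := by
      intro m n
      rw [dist_eq_norm, dist_eq_norm, ← MemLp.toLp_sub, ← MemLp.toLp_sub, Lp.norm_toLp,
        Lp.norm_toLp, StepFunction.eLpNorm_integral_sub hB]
    simpa only [this] using hc
  obtain ⟨Y, hY⟩ := cauchySeq_tendsto_of_complete hc'
  refine ⟨Y, hf, Lp.memLp Y, φ, hφ, ?_⟩
  refine (Lp.tendsto_Lp_iff_tendsto_eLpNorm'' _ (fun n ↦ (φ n).memLp_integral hB) Y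
    (Lp.memLp Y)).1 ?_
  rwa [Lp.toLp_coeFn]

theorem IsWienerIntegral.eLpNorm_eq (hB : IsTwoSidedBrownianMotion B P) {f : ℝ → ℝ} {Y : Ω → ℝ}
    (h : IsWienerIntegral B P f Y) : eLpNorm Y 2 P = eLpNorm f 2 volume := by
  obtain ⟨hf, hY, φ, hφ, hφY⟩ := h
  have h1 := ((Lp.tendsto_Lp_iff_tendsto_eLpNorm'' _ (fun n ↦ (φ n).memLp_toFun) f hf).2 hφ).norm
  have h2 := ((Lp.tendsto_Lp_iff_tendsto_eLpNorm'' _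
    (fun n ↦ (φ n).memLp_integral hB) Y hY).2 hφY).norm
  have h3 : ∀ n, eLpNorm ((φ n).integral B) 2 P = eLpNorm (φ n).toFun 2 volume := fun n ↦ by
    rw [eLpNorm_two_eq_ofReal_sqrt ((φ n).memLp_integral hB),
      eLpNorm_two_eq_ofReal_sqrt (φ n).memLp_toFun, StepFunction.integral_integral_sq hB]
  simp only [Lp.norm_toLp, h3] at h1 h2
  exact (ENNReal.toReal_eq_toReal_iff' hY.eLpNorm_ne_top hf.eLpNorm_ne_top).1
    (tendsto_nhds_unique h2 h1)

theorem IsWienerIntegral.congr {f g : ℝ → ℝ} {Y W : Ω → ℝ} (h : IsWienerIntegral B P f Y)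
    (hfg : f =ᵐ[volume] g) (hYW : Y =ᵐ[P] W) : IsWienerIntegral B P g W := by
  obtain ⟨hf, hY, φ, hφ, hφY⟩ := h
  refine ⟨(memLp_congr_ae hfg).1 hf, (memLp_congr_ae hYW).1 hY, φ, ?_, ?_⟩
  · refine hφ.congr fun n ↦ eLpNorm_congr_ae ?_
    filter_upwards [hfg] with s hs
    rw [hs]
  · refine hφY.congr fun n ↦ eLpNorm_congr_ae ?_
    filter_upwards [hYW] with ω hω
    rw [hω]

theorem IsWienerIntegral.add (hB : IsTwoSidedBrownianMotion B P) {f g : ℝ → ℝ} {Y W : Ω → ℝ}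
    (hf : IsWienerIntegral B P f Y) (hg : IsWienerIntegral B P g W) :
    IsWienerIntegral B P (f + g) (Y + W) := by
  obtain ⟨hf, hY, φ, hφ, hφY⟩ := hf
  obtain ⟨hg, hW, ψ, hψ, hψW⟩ := hg
  refine ⟨hf.add hg, hY.add hW, fun n ↦ (φ n).add (ψ n), ?_, ?_⟩
  · have := tendsto_eLpNorm_add_of_tendsto
      (fun n ↦ ((φ n).memLp_toFun.sub hf).aestronglyMeasurable)
      (fun n ↦ ((ψ n).memLp_toFun.sub hg).aestronglyMeasurable) hφ hψ
    refine this.congr fun n ↦ ?_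
    rw [StepFunction.toFun_add, sub_add_sub_comm]
    rfl
  · have := tendsto_eLpNorm_add_of_tendsto
      (fun n ↦ (((φ n).memLp_integral hB).sub hY).aestronglyMeasurable)
      (fun n ↦ (((ψ n).memLp_integral hB).sub hW).aestronglyMeasurable) hφY hψW
    refine this.congr fun n ↦ ?_
    rw [StepFunction.integral_add, sub_add_sub_comm]
    rfl

theorem IsWienerIntegral.const_smul {f : ℝ → ℝ} {Y : Ω → ℝ} (c : ℝ)
    (hf : IsWienerIntegral B P f Y) : IsWienerIntegral B P (c • f) (c • Y) := by
  obtain ⟨hf, hY, φ, hφ, hφY⟩ := hf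
  refine ⟨hf.const_smul c, hY.const_smul c, fun n ↦ (φ n).smul c, ?_, ?_⟩
  · have := ENNReal.Tendsto.const_mul (a := ‖c‖ₑ) hφ (Or.inr (by simp))
    rw [mul_zero] at this
    refine this.congr fun n ↦ ?_
    rw [StepFunction.toFun_smul, ← eLpNorm_const_smul]
    simp only [Pi.smul_def, smul_sub]
  · have := ENNReal.Tendsto.const_mul (a := ‖c‖ₑ) hφY (Or.inr (by simp))
    rw [mul_zero] at this
    refine this.congr fun n ↦ ?_
    rw [StepFunction.integral_smul, ← eLpNorm_const_smul]
    simp only [Pi.smul_def, smul_sub]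

theorem IsWienerIntegral.sub (hB : IsTwoSidedBrownianMotion B P) {f g : ℝ → ℝ} {Y W : Ω → ℝ}
    (hf : IsWienerIntegral B P f Y) (hg : IsWienerIntegral B P g W) :
    IsWienerIntegral B P (f - g) (Y - W) := by
  simpa [sub_eq_add_neg] using hf.add hB (hg.const_smul (-1))

/-- The difference is a Wiener integral of 0, so its norm is 0 by the isometry, whichever
approximating sequences were used. -/
theorem IsWienerIntegral.ae_eq (hB : IsTwoSidedBrownianMotion B P) {f : ℝ → ℝ} {Y W : Ω → ℝ}
    (hY : IsWienerIntegral B P f Y) (hW : IsWienerIntegral B P f W) : Y =ᵐ[P] W := by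
  have h := hY.sub hB hW
  have h0 := h.eLpNorm_eq hB
  rw [sub_self, eLpNorm_zero, eLpNorm_eq_zero_iff h.2.1.aestronglyMeasurable two_ne_zero] at h0
  filter_upwards [h0] with ω hω
  exact sub_eq_zero.1 hω

theorem isWienerIntegral_wienerIntegral (hB : IsTwoSidedBrownianMotion B P) {f : ℝ → ℝ}
    (hf : MemLp f 2 volume) : IsWienerIntegral B P f (wienerIntegral B P f) := by
  have h := exists_isWienerIntegral hB hf
  rw [wienerIntegral, dif_pos h]
  exact h.choose_spec

/-- The second moment of a Wiener integral. -/
theorem IsWienerIntegral.integral_sq (hB : IsTwoSidedBrownianMotion B P) {f : ℝ → ℝ} {Y : Ω → ℝ}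
    (h : IsWienerIntegral B P f Y) : ∫ ω, Y ω ^ 2 ∂P = ∫ s, f s ^ 2 :=
  integral_sq_eq_of_eLpNorm_eq h.2.1 h.1 (h.eLpNorm_eq hB)

theorem IsWienerIntegral.integral_eq_zero (hB : IsTwoSidedBrownianMotion B P) {f : ℝ → ℝ}
    {Y : Ω → ℝ} (h : IsWienerIntegral B P f Y) : ∫ ω, Y ω ∂P = 0 := by
  have := hB.isGaussianProcess.isProbabilityMeasure
  obtain ⟨-, hY, φ, -, hφY⟩ := h
  have hint := fun n ↦ (φ n).memLp_integral hB
  have h1 : Tendsto (fun n ↦ ∫ ω, (φ n).integral B ω ∂P) atTop (𝓝 (∫ ω, Y ω ∂P)) := by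
    refine tendsto_integral_of_L1' Y hY.aestronglyMeasurable
      (Eventually.of_forall fun n ↦ (hint n).integrable one_le_two) ?_
    refine tendsto_of_tendsto_of_tendsto_of_le_of_le tendsto_const_nhds hφY (fun _ ↦ zero_le) ?_
    exact fun n ↦ eLpNorm_le_eLpNorm_of_exponent_le one_le_two
      ((hint n).aestronglyMeasurable.sub hY.aestronglyMeasurable)
  simp_rw [StepFunction.integral_integral hB] at h1
  exact tendsto_nhds_unique h1 tendsto_const_nhds

/-- A family of Wiener integrals is a Gaussian process. -/
theorem isGaussianProcess_of_isWienerIntegral (hB : IsTwoSidedBrownianMotion B P) {T : Type*}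
    {f : T → ℝ → ℝ} {Y : T → Ω → ℝ} (h : ∀ t, IsWienerIntegral B P (f t) (Y t)) :
    IsGaussianProcess Y P := by
  have := hB.isGaussianProcess.isProbabilityMeasure
  choose hf hY φ hφ hφY using h
  exact isGaussianProcess_of_tendsto_eLpNorm
    (X := fun n t ↦ (φ t n).integral B)
    (fun n ↦ (StepFunction.isGaussianProcess_integral hB).comp_right fun t ↦ φ t n) hY hφY

end WienerIntegral

/-! ### The Mandelbrot–Van Ness kernel and its norm. -/

section Kernel

theorem measurable_posPow (a : ℝ) : Measurable fun x ↦ posPow x a := by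
  unfold posPow
  exact Measurable.ite measurableSet_Ioi (by fun_prop) measurable_const

theorem measurable_kernel (H t : ℝ) : Measurable (kernel H t) :=
  ((measurable_posPow _).comp (measurable_const.sub measurable_id)).sub
    ((measurable_posPow _).comp measurable_neg)

theorem posPow_mul {c : ℝ} (hc : 0 < c) (x a : ℝ) : posPow (c * x) a = c ^ a * posPow x a := by
  unfold posPow
  by_cases hx : 0 < x
  · rw [if_pos hx, if_pos (mul_pos hc hx), Real.mul_rpow hc.le hx.le]
  · rw [if_neg hx, if_neg (by rwa [mul_pos_iff_of_pos_left hc]), mul_zero]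

theorem kernel_zero (H : ℝ) : kernel H 0 = 0 := by
  ext s
  simp [kernel]

theorem kernel_eq_rescale (H : ℝ) {t : ℝ} (ht : 0 < t) (s : ℝ) :
    kernel H t s = t ^ (H - 1 / 2) * kernel H 1 (t⁻¹ * s) := by
  have h1 : t - s = t * (1 - t⁻¹ * s) := by field_simp
  have h2 : -s = t * -(t⁻¹ * s) := by field_simp
  rw [kernel, kernel, mul_sub, ← posPow_mul ht, ← posPow_mul ht, ← h1, ← h2]

/-- The terms in `(-x)₊` cancel; this is the source of stationary increments. -/
theorem kernel_sub_kernel (H t s : ℝ) :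
    kernel H t - kernel H s = fun x ↦ kernel H (t - s) (x - s) := by
  ext x
  simp [kernel]

theorem kernel_of_neg {H t s : ℝ} (ht : 0 ≤ t) (hs : s < 0) :
    kernel H t s = (t - s) ^ (H - 1 / 2) - (-s) ^ (H - 1 / 2) := by
  rw [kernel, posPow, posPow, if_pos (by linarith), if_pos (by linarith)]

theorem kernel_of_nonneg {H t s : ℝ} (hs : 0 ≤ s) : kernel H t s =
    (Iio t).indicator (fun s ↦ (t - s) ^ (H - 1 / 2)) s := by
  rw [kernel, posPow, posPow, if_neg (by linarith : ¬ 0 < -s), sub_zero]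
  simp [indicator_apply]

theorem abs_one_add_rpow_sub_one_le {a y : ℝ} (ha : |a| ≤ 1) (hy : 0 ≤ y) :
    |(1 + y) ^ a - 1| ≤ y := by
  have h1 : (1 + y) ^ a ≤ (1 + y) ^ (1 : ℝ) :=
    Real.rpow_le_rpow_of_exponent_le (by linarith) (abs_le.1 ha).2
  have h2 : (1 + y) ^ (-1 : ℝ) ≤ (1 + y) ^ a :=
    Real.rpow_le_rpow_of_exponent_le (by linarith) (abs_le.1 ha).1
  rw [Real.rpow_one] at h1
  rw [Real.rpow_neg_one] at h2
  have h3 : 1 - y ≤ (1 + y)⁻¹ := by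
    rw [inv_eq_one_div, le_div_iff₀ (by linarith)]
    nlinarith
  rw [abs_le]
  constructor <;> linarith

/-- Factoring out `x ^ a` leaves a bound by `x⁻¹`. The extra decay makes the square integrable at
infinity when `a < 1/2`. -/
theorem abs_one_add_rpow_sub_rpow_le {a x : ℝ} (ha : |a| ≤ 1) (hx : 0 < x) :
    |(1 + x) ^ a - x ^ a| ≤ x ^ (a - 1) := by
  have h : (1 + x) ^ a - x ^ a = x ^ a * ((1 + x⁻¹) ^ a - 1) := by
    rw [mul_sub, ← Real.mul_rpow hx.le (by positivity), mul_add, mul_one, mul_inv_cancel₀ hx.ne',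
      add_comm x 1, mul_one]
  rw [h, abs_mul, abs_of_pos (Real.rpow_pos_of_pos hx a), Real.rpow_sub_one hx.ne',
    div_eq_mul_inv]
  gcongr
  exact abs_one_add_rpow_sub_one_le ha (by positivity)

theorem integrableOn_one_add_rpow_sub_rpow_sq {a : ℝ} (ha : a ∈ Ioo (-1 / 2 : ℝ) (1 / 2)) :
    IntegrableOn (fun x : ℝ ↦ ((1 + x) ^ a - x ^ a) ^ 2) (Ioi 0) := by
  obtain ⟨ha1, ha2⟩ := ha
  have habs : |a| ≤ 1 := abs_le.2 ⟨by linarith, by linarith⟩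
  have hmeas : Measurable fun x : ℝ ↦ ((1 + x) ^ a - x ^ a) ^ 2 := by fun_prop
  have hsq : ∀ {x : ℝ}, 0 < x → ∀ b : ℝ, (x ^ b) ^ 2 = x ^ (2 * b) := fun hx b ↦ by
    rw [mul_comm, Real.rpow_mul hx.le, Real.rpow_two]
  rw [← Ioc_union_Ioi_eq_Ioi zero_le_one]
  refine IntegrableOn.union ?_ ?_
  -- From `(u - v)² ≤ 2u² + 2v²` with `u = (1 + x) ^ a ≤ 2`; here `a > -1/2` makes `x ^ (2 * a)`
  -- integrable at 0.
  · have hint : IntegrableOn (fun x : ℝ ↦ 8 + 2 * x ^ (2 * a)) (Ioc 0 1) := by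
      refine Integrable.add (by simp) (Integrable.const_mul ?_ 2)
      exact (intervalIntegrable_iff_integrableOn_Ioc_of_le zero_le_one).1
        (intervalIntegral.intervalIntegrable_rpow' (by linarith))
    refine hint.mono' hmeas.aestronglyMeasurable ?_
    filter_upwards [ae_restrict_mem measurableSet_Ioc] with x hx
    rw [Real.norm_eq_abs, abs_of_nonneg (sq_nonneg _), ← hsq hx.1]
    have h1 : (1 + x) ^ a ≤ 2 :=
      (Real.rpow_le_rpow_of_exponent_le (by linarith [hx.1]) (abs_le.1 habs).2).trans
        (by rw [Real.rpow_one]; linarith [hx.2])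
    have h2 : 0 ≤ (1 + x) ^ a := Real.rpow_nonneg (by linarith [hx.1]) _
    nlinarith [sq_nonneg ((1 + x) ^ a + x ^ a)]
  · have hint : IntegrableOn (fun x : ℝ ↦ x ^ (2 * (a - 1))) (Ioi 1) :=
      integrableOn_Ioi_rpow_of_lt (by linarith) one_pos
    refine hint.mono' hmeas.aestronglyMeasurable ?_
    filter_upwards [ae_restrict_mem measurableSet_Ioi] with x hx
    have hx0 : 0 < x := one_pos.trans hx
    rw [Real.norm_eq_abs, abs_of_nonneg (sq_nonneg _), ← hsq hx0, ← sq_abs]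
    gcongr
    exact abs_one_add_rpow_sub_rpow_le habs hx0

theorem integrableOn_Iio_one_sub_rpow_sub_rpow_sq {H : ℝ} (hH : H ∈ Ioo (0 : ℝ) 1) :
    IntegrableOn (fun s : ℝ ↦ ((1 - s) ^ (H - 1 / 2) - (-s) ^ (H - 1 / 2)) ^ 2) (Iio 0) := by
  have h := integrableOn_one_add_rpow_sub_rpow_sq (a := H - 1 / 2)
    ⟨by linarith [hH.1], by linarith [hH.2]⟩
  rw [← neg_zero] at h
  simpa only [sub_eq_add_neg] using h.comp_neg_Iio

theorem normConst_base_pos {H : ℝ} (hH : 0 < H) :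
    0 < (∫ s in Iio (0 : ℝ), ((1 - s) ^ (H - 1 / 2) - (-s) ^ (H - 1 / 2)) ^ 2) + 1 / (2 * H) :=
  add_pos_of_nonneg_of_pos (integral_nonneg fun _ ↦ sq_nonneg _) (by positivity)

theorem normConst_pos {H : ℝ} (hH : 0 < H) : 0 < normConst H :=
  Real.rpow_pos_of_pos (normConst_base_pos hH) _

theorem normConst_sq {H : ℝ} (hH : 0 < H) : normConst H ^ 2 =
    (∫ s in Iio (0 : ℝ), ((1 - s) ^ (H - 1 / 2) - (-s) ^ (H - 1 / 2)) ^ 2) + 1 / (2 * H) := by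
  rw [normConst, ← Real.sqrt_eq_rpow, Real.sq_sqrt (normConst_base_pos hH).le]

/-- The point `s = 1` has to go because of `H = 1/2`: there the right side is `0 ^ 0 = 1`, the left
side 0. -/
theorem kernel_one_sq_of_nonneg {H s : ℝ} (hs : 0 ≤ s) (hs1 : s ≠ 1) :
    kernel H 1 s ^ 2 = (Icc 0 1).indicator (fun s ↦ (1 - s) ^ (2 * H - 1)) s := by
  rw [kernel_of_nonneg hs]
  by_cases h : s < 1
  · rw [indicator_of_mem (by exact h), indicator_of_mem (show s ∈ Icc 0 1 from ⟨hs, h.le⟩),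
      ← Real.rpow_natCast,
      ← Real.rpow_mul (by linarith)]
    congr 1
    push_cast
    ring
  · rw [indicator_of_notMem (by exact h), indicator_of_notMem]
    · simp
    · exact fun h' ↦ hs1 (le_antisymm h'.2 (not_lt.1 h))

theorem intervalIntegrable_one_sub_rpow {H : ℝ} (hH : 0 < H) :
    IntervalIntegrable (fun s : ℝ ↦ (1 - s) ^ (2 * H - 1)) volume 0 1 := by
  have h : IntervalIntegrable (fun s : ℝ ↦ s ^ (2 * H - 1)) volume 0 1 :=
    intervalIntegral.intervalIntegrable_rpow' (by linarith)
  simpa using (h.comp_sub_left 1).symm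

theorem kernel_one_sq_Ici {H : ℝ} (hH : 0 < H) :
    IntegrableOn (fun s ↦ kernel H 1 s ^ 2) (Ici 0) ∧
      ∫ s in Ici 0, kernel H 1 s ^ 2 = 1 / (2 * H) := by
  have hae : (fun s ↦ kernel H 1 s ^ 2) =ᵐ[volume.restrict (Ici 0)]
      (Icc 0 1).indicator fun s ↦ (1 - s) ^ (2 * H - 1) := by
    filter_upwards [ae_restrict_mem measurableSet_Ici,
      ae_restrict_of_ae (Measure.ae_ne volume (1 : ℝ))] with s hs hs1
    exact kernel_one_sq_of_nonneg hs hs1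
  constructor
  · refine Integrable.congr ?_ hae.symm
    refine Integrable.integrableOn ?_
    rw [integrable_indicator_iff measurableSet_Icc, integrableOn_Icc_iff_integrableOn_Ioc]
    exact (intervalIntegrable_iff_integrableOn_Ioc_of_le zero_le_one).1
      (intervalIntegrable_one_sub_rpow hH)
  · rw [integral_congr_ae hae, setIntegral_indicator measurableSet_Icc,
      inter_eq_self_of_subset_right Icc_subset_Ici_self, integral_Icc_eq_integral_Ioc,
      ← intervalIntegral.integral_of_le zero_le_one,
      intervalIntegral.integral_comp_sub_left (fun x : ℝ ↦ x ^ (2 * H - 1)) 1,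
      integral_rpow (Or.inl (by linarith))]
    have : 2 * H ≠ 0 := by positivity
    simp [this]

theorem kernel_one_sq {H : ℝ} (hH : H ∈ Ioo (0 : ℝ) 1) :
    Integrable (fun s ↦ kernel H 1 s ^ 2) ∧ ∫ s, kernel H 1 s ^ 2 = normConst H ^ 2 := by
  have heq : EqOn (fun s : ℝ ↦ ((1 - s) ^ (H - 1 / 2) - (-s) ^ (H - 1 / 2)) ^ 2)
      (fun s ↦ kernel H 1 s ^ 2) (Iio 0) := fun s hs ↦ by
    simp only [kernel_of_neg zero_le_one hs]
  have h1 : IntegrableOn (fun s ↦ kernel H 1 s ^ 2) (Iio 0) :=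
    (integrableOn_Iio_one_sub_rpow_sub_rpow_sq hH).congr_fun heq measurableSet_Iio
  obtain ⟨h2, h3⟩ := kernel_one_sq_Ici hH.1
  have hint : Integrable (fun s ↦ kernel H 1 s ^ 2) := by
    rw [← integrableOn_univ, ← Iio_union_Ici (a := (0 : ℝ))]
    exact h1.union h2
  refine ⟨hint, ?_⟩
  rw [normConst_sq hH.1, ← h3, setIntegral_congr_fun measurableSet_Iio heq, ← compl_Iio,
    integral_add_compl measurableSet_Iio hint]

theorem kernel_sq {H : ℝ} (hH : H ∈ Ioo (0 : ℝ) 1) {t : ℝ} (ht : 0 ≤ t) :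
    Integrable (fun s ↦ kernel H t s ^ 2) ∧
      ∫ s, kernel H t s ^ 2 = t ^ (2 * H) * normConst H ^ 2 := by
  obtain ⟨h1, h2⟩ := kernel_one_sq hH
  rcases ht.eq_or_lt with rfl | ht
  · simp [kernel_zero, Real.zero_rpow (mul_pos two_pos hH.1).ne']
  have heq : (fun s ↦ kernel H t s ^ 2) =
      fun s ↦ (t ^ (H - 1 / 2)) ^ 2 * kernel H 1 (t⁻¹ * s) ^ 2 := by
    ext s
    rw [kernel_eq_rescale H ht, mul_pow]
  rw [heq]
  -- The squared prefactor `t ^ (2 * H - 1)` times the Jacobian `t` gives `t ^ (2 * H)`.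
  refine ⟨(h1.comp_mul_left' (inv_ne_zero ht.ne')).const_mul _, ?_⟩
  rw [integral_const_mul, Measure.integral_comp_mul_left (fun s ↦ kernel H 1 s ^ 2), h2, inv_inv,
    abs_of_pos ht, smul_eq_mul, ← mul_assoc, ← Real.rpow_natCast, ← Real.rpow_mul ht.le,
    ← Real.rpow_add_one ht.ne']
  congr 2
  push_cast
  ring

theorem memLp_kernel {H : ℝ} (hH : H ∈ Ioo (0 : ℝ) 1) {t : ℝ} (ht : 0 ≤ t) :
    MemLp (kernel H t) 2 volume :=
  (memLp_two_iff_integrable_sq (measurable_kernel H t).aestronglyMeasurable).2 (kernel_sq hH ht).1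

theorem integral_kernel_sub_kernel_sq {H : ℝ} (hH : H ∈ Ioo (0 : ℝ) 1) (t s : ℝ) :
    ∫ x, (kernel H t - kernel H s) x ^ 2 = |t - s| ^ (2 * H) * normConst H ^ 2 := by
  wlog h : s ≤ t generalizing s t
  · rw [abs_sub_comm, ← this s t (le_of_not_ge h)]
    refine integral_congr_ae (Eventually.of_forall fun x ↦ ?_)
    simp only [Pi.sub_apply]
    ring
  rw [kernel_sub_kernel, integral_sub_right_eq_self (fun x ↦ kernel H (t - s) x ^ 2) s,
    (kernel_sq hH (sub_nonneg.2 h)).2, abs_of_nonneg (sub_nonneg.2 h)]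

theorem indicator_Iio_eq_indicator_kernel (H : ℝ) {t : ℝ} (ht : 0 ≤ t) :
    ((Iio (0 : ℝ)).indicator fun s ↦ (t - s) ^ (H - 1 / 2) - (-s) ^ (H - 1 / 2)) =
      (Iio (0 : ℝ)).indicator (kernel H t) :=
  indicator_congr fun _ hs ↦ (kernel_of_neg ht hs).symm

theorem indicator_Ioo_eq_indicator_kernel (H t : ℝ) :
    ((Ioo (0 : ℝ) t).indicator fun s ↦ (t - s) ^ (H - 1 / 2)) =
      (Ioo (0 : ℝ) t).indicator (kernel H t) :=
  indicator_congr fun s hs ↦ by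
    rw [kernel_of_nonneg hs.1.le, indicator_of_mem (by exact hs.2)]

theorem indicator_Iio_add_indicator_Ioo_ae_eq_kernel (H t : ℝ) :
    (Iio (0 : ℝ)).indicator (kernel H t) + (Ioo (0 : ℝ) t).indicator (kernel H t)
      =ᵐ[volume] kernel H t := by
  -- At `s = 0` both indicators vanish, while the kernel equals `t ^ (H - 1 / 2)` for `t > 0`.
  filter_upwards [Measure.ae_ne volume (0 : ℝ)] with s hs
  rw [Pi.add_apply]
  rcases lt_or_gt_of_ne hs with h | h
  · simp [h, h.le]
  · rw [indicator_of_notMem (by simp [h.le]), zero_add]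
    by_cases hst : s < t
    · rw [indicator_of_mem (show s ∈ Ioo 0 t from ⟨h, hst⟩)]
    · rw [indicator_of_notMem (by simp [hst]), kernel_of_nonneg h.le,
        indicator_of_notMem (by exact hst)]

end Kernel

/-! ### The kernel as a fractional integral. -/

section FractionalIntegral

theorem intervalIntegrable_posPow {b : ℝ} (hb : -1 < b) (p q : ℝ) :
    IntervalIntegrable (fun x ↦ posPow x b) volume p q := by
  have h : IntervalIntegrable (fun x : ℝ ↦ x ^ b) volume p q :=
    intervalIntegral.intervalIntegrable_rpow' hb
  have heq : (fun x ↦ posPow x b) = (Ioi 0).indicator fun x : ℝ ↦ x ^ b := by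
    ext x
    simp [posPow, indicator_apply]
  rw [heq]
  exact ⟨h.1.indicator measurableSet_Ioi, h.2.indicator measurableSet_Ioi⟩

theorem integral_posPow {b : ℝ} (hb : -1 < b) (p q : ℝ) :
    ∫ x in p..q, posPow x b = (posPow q (b + 1) - posPow p (b + 1)) / (b + 1) := by
  have hb1 : 0 < b + 1 := by linarith
  have key : ∀ q, ∫ x in 0..q, posPow x b = posPow q (b + 1) / (b + 1) := by
    intro q
    rcases le_or_gt q 0 with hq | hq
    · rw [posPow, if_neg hq.not_gt, zero_div]
      refine intervalIntegral.integral_zero_ae (Eventually.of_forall fun x hx ↦ ?_)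
      rw [uIoc_of_ge hq] at hx
      rw [posPow, if_neg hx.2.not_gt]
    · rw [posPow, if_pos hq]
      have : ∫ x in 0..q, posPow x b = ∫ x in 0..q, x ^ b := by
        refine intervalIntegral.integral_congr_ae (Eventually.of_forall fun x hx ↦ ?_)
        rw [uIoc_of_le hq.le] at hx
        rw [posPow, if_pos hx.1]
      rw [this, integral_rpow (Or.inl hb), Real.zero_rpow hb1.ne', sub_zero]
  rw [← intervalIntegral.integral_interval_sub_left (intervalIntegrable_posPow hb 0 q)
    (intervalIntegrable_posPow hb 0 p), key, key, sub_div]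

theorem indicator_Icc_one_mul (t : ℝ) (g : ℝ → ℝ) :
    (fun u ↦ (Icc (0 : ℝ) t).indicator (fun _ ↦ (1 : ℝ)) u * g u) = (Icc 0 t).indicator g := by
  ext u
  by_cases hu : u ∈ Icc 0 t <;> simp [hu]

theorem integrable_indicator_mul_posPow {b : ℝ} (hb : -1 < b) {t : ℝ} (ht : 0 ≤ t) (s : ℝ) :
    Integrable fun u : ℝ ↦ (Icc (0 : ℝ) t).indicator (fun _ ↦ (1 : ℝ)) u * posPow (u - s) b := by
  rw [indicator_Icc_one_mul, integrable_indicator_iff measurableSet_Icc,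
    integrableOn_Icc_iff_integrableOn_Ioc, ← intervalIntegrable_iff_integrableOn_Ioc_of_le ht]
  simpa using (intervalIntegrable_posPow hb (0 - s) (t - s)).comp_sub_right s

/-- For `H > 1/2` the kernel is a fractional integral of an indicator function. -/
theorem kernel_eq_fracIntMinus {H : ℝ} (hH : 1 / 2 < H) {t : ℝ} (ht : 0 ≤ t) (s : ℝ) :
    kernel H t s = Real.Gamma (H + 1 / 2) *
      fracIntMinus (H - 1 / 2) ((Icc (0 : ℝ) t).indicator fun _ ↦ (1 : ℝ)) s := by
  have ha : 0 < H - 1 / 2 := by linarith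
  have hG : Real.Gamma (H + 1 / 2) = (H - 1 / 2) * Real.Gamma (H - 1 / 2) := by
    rw [← Real.Gamma_add_one ha.ne']
    congr 1
    ring
  have hG0 : Real.Gamma (H - 1 / 2) ≠ 0 := (Real.Gamma_pos_of_pos ha).ne'
  -- Substituting `x = u - s` produces the kernel divided by `H - 1 / 2`, the factor that `hG`
  -- supplies.
  rw [fracIntMinus, indicator_Icc_one_mul, integral_indicator measurableSet_Icc,
    integral_Icc_eq_integral_Ioc, ← intervalIntegral.integral_of_le ht,
    intervalIntegral.integral_comp_sub_right (fun x ↦ posPow x (H - 1 / 2 - 1)) s,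
    integral_posPow (by linarith), sub_add_cancel, zero_sub, hG, kernel]
  generalize H - 1 / 2 = a at *
  field_simp

end FractionalIntegral

/-! ### Fractional Brownian motion and the two other representations. -/

variable {Ω : Type*} [MeasurableSpace Ω] {P : Measure Ω} {B : ℝ → Ω → ℝ}

/-- The Mandelbrot-Van Ness integral is a fractional Brownian motion. -/
theorem isFractionalBrownianMotion_of_isWienerIntegral (hB : IsTwoSidedBrownianMotion B P) {H : ℝ}
    (hH : H ∈ Ioo (0 : ℝ) 1) {Z : ℝ≥0 → Ω → ℝ}
    (hZ : ∀ t : ℝ≥0, IsWienerIntegral B P ((1 / normConst H) • kernel H t) (Z t)) :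
    IsFractionalBrownianMotion H Z P where
  hurst_mem := hH
  gaussian := isGaussianProcess_of_isWienerIntegral hB hZ
  mean_zero t := (hZ t).integral_eq_zero hB
  covariance t s := by
    have hC := (normConst_pos hH.1).ne'
    have hsq : ∀ t : ℝ≥0, ∫ ω, Z t ω ^ 2 ∂P = (t : ℝ) ^ (2 * H) := fun t ↦ by
      rw [(hZ t).integral_sq hB]
      simp only [Pi.smul_apply, smul_eq_mul, mul_pow]
      rw [integral_const_mul, (kernel_sq hH t.coe_nonneg).2]
      field_simp
    have hsub : ∫ ω, (Z t - Z s) ω ^ 2 ∂P = |(t : ℝ) - s| ^ (2 * H) := by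
      rw [((hZ t).sub hB (hZ s)).integral_sq hB, ← smul_sub]
      simp only [Pi.smul_apply, smul_eq_mul, mul_pow]
      rw [integral_const_mul, integral_kernel_sub_kernel_sq hH]
      field_simp
    have ht := (hZ t).2.1
    have hs := (hZ s).2.1
    -- Polarization: the covariance follows from second moments of values and of increments.
    have hpol : ∀ ω, Z t ω * Z s ω = 1 / 2 * (Z t ω ^ 2 + Z s ω ^ 2 - (Z t - Z s) ω ^ 2) :=
      fun ω ↦ by
        simp only [Pi.sub_apply]
        ring
    have hadd : Integrable (fun ω ↦ Z t ω ^ 2 + Z s ω ^ 2) P :=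
      ht.integrable_sq.add hs.integrable_sq
    simp_rw [hpol]
    rw [integral_const_mul, integral_sub hadd (ht.sub hs).integrable_sq,
      integral_add ht.integrable_sq hs.integrable_sq, hsq, hsq, hsub]

theorem wienerIntegral_kernel_ae_eq (hB : IsTwoSidedBrownianMotion B P) {H : ℝ}
    (hH : H ∈ Ioo (0 : ℝ) 1) {t : ℝ} (ht : 0 ≤ t) :
    wienerIntegral B P (kernel H t) =ᵐ[P]
      wienerIntegralOn B P (Iio 0) (fun s ↦ (t - s) ^ (H - 1 / 2) - (-s) ^ (H - 1 / 2)) +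
        wienerIntegralOn B P (Ioo 0 t) fun s ↦ (t - s) ^ (H - 1 / 2) := by
  have hk := memLp_kernel hH ht
  rw [wienerIntegralOn, wienerIntegralOn, indicator_Iio_eq_indicator_kernel H ht,
    indicator_Ioo_eq_indicator_kernel]
  have h := (isWienerIntegral_wienerIntegral hB (hk.indicator (measurableSet_Iio (a := 0)))).add hB
    (isWienerIntegral_wienerIntegral hB (hk.indicator (measurableSet_Ioo (a := 0) (b := t))))
  exact (isWienerIntegral_wienerIntegral hB hk).ae_eq hB
    (h.congr (indicator_Iio_add_indicator_Ioo_ae_eq_kernel H t) .rfl)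

theorem wienerIntegral_kernel_ae_eq_fracIntMinus (hB : IsTwoSidedBrownianMotion B P) {H : ℝ}
    (hH : H ∈ Ioo (0 : ℝ) 1) (hH2 : 1 / 2 < H) {t : ℝ} (ht : 0 ≤ t) :
    wienerIntegral B P (kernel H t) =ᵐ[P] Real.Gamma (H + 1 / 2) •
      wienerIntegral B P
        (fracIntMinus (H - 1 / 2) ((Icc (0 : ℝ) t).indicator fun _ ↦ (1 : ℝ))) := by
  have hG : Real.Gamma (H + 1 / 2) ≠ 0 := (Real.Gamma_pos_of_pos (by linarith)).ne'
  have hk := memLp_kernel hH ht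
  have heq : kernel H t = Real.Gamma (H + 1 / 2) •
      fracIntMinus (H - 1 / 2) ((Icc (0 : ℝ) t).indicator fun _ ↦ (1 : ℝ)) :=
    funext fun s ↦ kernel_eq_fracIntMinus hH2 ht s
  -- Square integrability is inherited from the kernel, the Gamma factor being nonzero.
  have hf : MemLp (fracIntMinus (H - 1 / 2) ((Icc (0 : ℝ) t).indicator fun _ ↦ (1 : ℝ))) 2
      volume := by
    have := hk.const_smul (Real.Gamma (H + 1 / 2))⁻¹
    rwa [heq, inv_smul_smul₀ hG] at this
  have h := (isWienerIntegral_wienerIntegral hB hf).const_smul (Real.Gamma (H + 1 / 2))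
  rw [← heq] at h
  exact (isWienerIntegral_wienerIntegral hB hk).ae_eq hB h

end MandelbrotVanNess

theorem mainTheorem3 {Ω : Type*} [MeasurableSpace Ω] (P : Measure Ω) [IsProbabilityMeasure P]
    (B : ℝ → Ω → ℝ) (hB : IsTwoSidedBrownianMotion B P) (H : ℝ) (hH : H ∈ Ioo (0 : ℝ) 1) :
    -- the constant `C(H)` is well defined and positive
    IntegrableOn (fun s : ℝ ↦ ((1 - s) ^ (H - 1 / 2) - (-s) ^ (H - 1 / 2)) ^ 2) (Iio 0) ∧
    0 < normConst H ∧
    -- Wiener integrals of `L²` functions exist and are unique up to null sets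
    (∀ f : ℝ → ℝ, MemLp f 2 volume →
      IsWienerIntegral B P f (wienerIntegral B P f) ∧
      ∀ Y : Ω → ℝ, IsWienerIntegral B P f Y → Y =ᵐ[P] wienerIntegral B P f) ∧
    -- the integrands are in `L²`
    (∀ t : ℝ≥0, MemLp (kernel H t) 2 volume ∧
      MemLp ((Iio (0 : ℝ)).indicator
        fun s ↦ ((t : ℝ) - s) ^ (H - 1 / 2) - (-s) ^ (H - 1 / 2)) 2 volume ∧
      MemLp ((Ioo (0 : ℝ) t).indicator fun s ↦ ((t : ℝ) - s) ^ (H - 1 / 2)) 2 volume) ∧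
    -- for `1/2 < H` the kernel is a fractional integral of an indicator function
    (1 / 2 < H → ∀ (t : ℝ≥0) (s : ℝ),
      Integrable (fun u : ℝ ↦ (Icc (0 : ℝ) t).indicator (fun _ ↦ (1 : ℝ)) u *
        posPow (u - s) (H - 1 / 2 - 1)) volume ∧
      kernel H t s = Real.Gamma (H + 1 / 2) *
        fracIntMinus (H - 1 / 2) ((Icc (0 : ℝ) t).indicator fun _ ↦ (1 : ℝ)) s) ∧
    -- every version `Z` of the normalized integral is a fractional Brownian motion
    ∀ Z : ℝ≥0 → Ω → ℝ,
      (∀ t : ℝ≥0, Z t =ᵐ[P] fun ω ↦ 1 / normConst H * wienerIntegral B P (kernel H t) ω) →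
      IsFractionalBrownianMotion H Z P ∧
      (∀ t : ℝ≥0, Z t =ᵐ[P] fun ω ↦ 1 / normConst H *
        (wienerIntegralOn B P (Iio 0)
            (fun s ↦ ((t : ℝ) - s) ^ (H - 1 / 2) - (-s) ^ (H - 1 / 2)) ω +
          wienerIntegralOn B P (Ioo 0 (t : ℝ)) (fun s ↦ ((t : ℝ) - s) ^ (H - 1 / 2)) ω)) ∧
      (1 / 2 < H → ∀ t : ℝ≥0, Z t =ᵐ[P] fun ω ↦ Real.Gamma (H + 1 / 2) / normConst H *
        wienerIntegral B P
          (fracIntMinus (H - 1 / 2) ((Icc (0 : ℝ) t).indicator fun _ ↦ (1 : ℝ))) ω) := by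
  refine ⟨integrableOn_Iio_one_sub_rpow_sub_rpow_sq hH, normConst_pos hH.1, fun f hf ↦ ?_,
    fun t ↦ ?_, fun hH2 t s ↦ ?_, fun Z hZ ↦ ?_⟩
  · have h := isWienerIntegral_wienerIntegral hB hf
    exact ⟨h, fun Y hY ↦ hY.ae_eq hB h⟩
  · have hk := memLp_kernel hH t.coe_nonneg
    refine ⟨hk, ?_, ?_⟩
    · rw [indicator_Iio_eq_indicator_kernel H t.coe_nonneg]
      exact hk.indicator measurableSet_Iio
    · rw [indicator_Ioo_eq_indicator_kernel]
      exact hk.indicator measurableSet_Ioo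
  · exact ⟨integrable_indicator_mul_posPow (by linarith) t.coe_nonneg s,
      kernel_eq_fracIntMinus hH2 t.coe_nonneg s⟩
  · refine ⟨isFractionalBrownianMotion_of_isWienerIntegral hB hH fun t ↦ ?_, fun t ↦ ?_,
      fun hH2 t ↦ ?_⟩
    · exact ((isWienerIntegral_wienerIntegral hB (memLp_kernel hH t.coe_nonneg)).const_smul _).congr
        .rfl (hZ t).symm
    · filter_upwards [hZ t, wienerIntegral_kernel_ae_eq hB hH t.coe_nonneg] with ω h1 h2
      rw [h1, h2]
      rfl
    · filter_upwards [hZ t,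
        wienerIntegral_kernel_ae_eq_fracIntMinus hB hH hH2 t.coe_nonneg] with ω h1 h2
      rw [h1, h2, Pi.smul_apply, smul_eq_mul, ← mul_assoc, div_mul_eq_mul_div, one_mul]
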